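/- **Theorem 3.2.** Let $M$ be a monoid. An *atom* of $M$ is an element $a\neq 1$ such that $a=bc$ implies $b=1$ or $c=1$; $M$ is *atomic* if it is generated by its atoms and, for every $a\in M$, the lengths of the expressions of $a$ as a product of atoms are bounded. Write $a\le_L b$ if $ac=b$ for some $c\in M$, and $a\le_R b$ if $ca=b$ for some $c\in M$. A *Garside element* of $M$ is an element $\Delta$ such that for all $a\in M$ one has $a\le_L\Delta$ if and only if $a\le_R\Delta$, and such that $\{a\in M: a\le_L\Delta\}$ generates $M$. An atomic monoid $M$ is a *Garside monoid* if it is finitely generated, left and right cancellative, $(M,\le_L)$ and $(M,\le_R)$ are lattices, and $M$ has a Garside element. Let $M\ne\{1\}$ be a Garside monoid with a Garside element $\Delta$, and let $G$ be its group of fractions (a Garside group), that is, a group containing $M$ as a submonoid in which every element is of the form $ab^{-1}$ with $a,b\in M$. For $g,h\in G$ write $g\le_L h$ if $gc=h$ for some $c\in M$, and put $$\inf(g)=\max\{r\in\mathbb Z:\Delta^r\le_L g\},\qquad \inf\nolimits_s(g)=\max\{\inf(x^{-1}gx):x\in G\},\qquad t_{\inf}(g)=\lim_{n\to\infty}\frac{\inf(g^n)}{n}.$$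 Then for every $g\in G$ these maxima and this limit exist, and $$\inf\nolimits_s(g)\le t_{\inf}(g)<\inf\nolimits_s(g)+1;\qquad\text{consequently}\qquad \inf\nolimits_s(g)=\lfloor t_{\inf}(g)\rfloor .$$ -/

import Mathlib

open Filter Topology

namespace Garside

section MonoidDefs

variable {M : Type*} [Monoid M]

/-- Atoms of a monoid: elements `a ≠ 1` such that `a = b * c` implies `b = 1` or `c = 1`. -/
def IsMonoidAtom (a : M) : Prop :=
  a ≠ 1 ∧ ∀ b c : M, a = b * c → b = 1 ∨ c = 1

/-- `‖a‖`: the supremum in `ℕ∞` of the lengths of all expressions of `a` as a product of atoms. -/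
noncomputable def atomNorm (a : M) : ℕ∞ :=
  ⨆ l ∈ {l : List M | (∀ x ∈ l, IsMonoidAtom x) ∧ l.prod = a}, (l.length : ℕ∞)

variable (M) in
/-- Atomic monoids: generated by the atoms, with `‖a‖ < ∞` for every `a`. -/
structure IsAtomicMonoid : Prop where
  closure_atoms : Submonoid.closure {a : M | IsMonoidAtom a} = ⊤
  norm_lt_top : ∀ a : M, atomNorm a < ⊤

/-- `a ≤_L b`: `a * c = b` for some `c`. -/
def LeL (a b : M) : Prop := ∃ c : M, a * c = b

/-- `a ≤_R b`: `c * a = b` for some `c`. -/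
def LeR (a b : M) : Prop := ∃ c : M, c * a = b

/-- The relation `r` is a partial order on `α` in which any two elements have a least upper bound
and a greatest lower bound. -/
structure IsLatticeOrder {α : Type*} (r : α → α → Prop) : Prop where
  refl : ∀ a, r a a
  trans : ∀ a b c, r a b → r b c → r a c
  antisymm : ∀ a b, r a b → r b a → a = b
  exists_join : ∀ a b, ∃ j, r a j ∧ r b j ∧ ∀ c, r a c → r b c → r j c
  exists_meet : ∀ a b, ∃ m, r m a ∧ r m b ∧ ∀ c, r c a → r c b → r c m

/-- Garside elements: the left divisors of `Δ` are its right divisors, and they generate `M`. -/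
structure IsGarsideElement (Δ : M) : Prop where
  leL_iff_leR : ∀ a : M, LeL a Δ ↔ LeR a Δ
  closure_simple : Submonoid.closure {a : M | LeL a Δ} = ⊤

variable (M) in
/-- Garside monoids. -/
structure IsGarsideMonoid : Prop where
  atomic : IsAtomicMonoid M
  fg : Monoid.FG M
  left_cancel : ∀ a b c : M, a * b = a * c → b = c
  right_cancel : ∀ a b c : M, b * a = c * a → b = c
  latticeL : IsLatticeOrder (LeL : M → M → Prop)
  latticeR : IsLatticeOrder (LeR : M → M → Prop)
  exists_garsideElement : ∃ Δ : M, IsGarsideElement Δ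

end MonoidDefs

section GroupDefs

variable {M G : Type*} [Monoid M] [Group G]

/-- `G`, with `ι : M → G`, is a group of fractions of `M`: `ι` identifies `M` with a submonoid of
`G`, and every element of `G` is a fraction `a b⁻¹` with `a, b ∈ M`. -/
structure IsGroupOfFractions (ι : M →* G) : Prop where
  injective : Function.Injective ι
  exists_fraction : ∀ g : G, ∃ a b : M, g = ι a * (ι b)⁻¹

/-- The order `≤_L` on the group of fractions: `g ≤_L h` if `g * c = h` for some positive `c`. -/
def GroupLeL (ι : M →* G) (g h : G) : Prop := ∃ c : M, g * ι c = h

/-- The integers `r` with `Δ ^ r ≤_L g`. -/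
def infSet (ι : M →* G) (Δ : M) (g : G) : Set ℤ :=
  {r : ℤ | GroupLeL ι (ι Δ ^ r) g}

/-- `inf(g) = max {r ∈ ℤ : Δ ^ r ≤_L g}`. -/
noncomputable def inf (ι : M →* G) (Δ : M) (g : G) : ℤ :=
  sSup (infSet ι Δ g)

/-- The conjugacy class `[g] = {x⁻¹ g x : x ∈ G}`. -/
def conjClass (g : G) : Set G := {h : G | ∃ x : G, h = x⁻¹ * g * x}

/-- `inf_s(g) = max {inf(h) : h ∈ [g]}`. -/
noncomputable def infS (ι : M →* G) (Δ : M) (g : G) : ℤ :=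
  sSup (inf ι Δ '' conjClass g)

/-- `t_inf(g) = lim inf(g ^ n) / n`, the limit being taken as `n → ∞`. -/
noncomputable def tInf (ι : M →* G) (Δ : M) (g : G) : ℝ :=
  limUnder atTop (fun n : ℕ => (inf ι Δ (g ^ n) : ℝ) / (n : ℝ))

end GroupDefs

end Garside

/-! Since `Δ` normalizes `M`, `inf` is superadditive. Fekete's lemma gives the limit, and
conjugating by `x` changes `inf (g ^ n)` by a bounded amount, so `inf` of every conjugate is at most
`t_inf(g)`.

For the strict bound, let `s ≤ t_inf(g)` be an integer. Then `Δ ^ s ≤_L x⁻¹ g x` means `φ x ≤ x`,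
where `φ x = g⁻¹ x Δ ^ s` is an order automorphism commuting with `T x = x Δ`. Let `N` exceed the
atomic length of `Δ`. The points `φ ^ n T ^ (-k) 1` with `n ≤ N k` are bounded above because `inf (g
^ n)` is eventually at least `(s - 1 / N) n`. Their supremum `y` satisfies `φ ^ i y ≤ T y` for `i ≤
N`. The joins of `y, φ y, …, φ ^ i y` climb inside `[y, T y]`, too short for `N` strict steps, so
they stall at a point with `φ x ≤ x` (`exists_apply_le_self`). -/

namespace Garside

/-! ### Automorphisms of join-semilattices -/

section Order

variable {α : Type*} [SemilatticeSup α]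

/-- If a rank function is strictly increasing above some element of a set that is bounded above,
then the set has a least upper bound. -/
theorem exists_isLUB_of_strictMonoOn {S : Set α} {a b : α} (ha : a ∈ S) (hb : b ∈ upperBounds S)
    {ρ : α → ℕ} (hρ : StrictMonoOn ρ (Set.Ici a)) : ∃ z, IsLUB S z := by
  classical
  -- `D` is stable under joins with elements of `S`, so a rank-maximal element of `D` bounds `S`.
  let D : Set α := {z | a ≤ z ∧ ∀ c ∈ upperBounds S, z ≤ c}
  have haD : a ∈ D := ⟨le_rfl, fun c hc => hc ha⟩
  have hbd : BddAbove (ρ '' D) := by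
    refine ⟨ρ b, ?_⟩
    rintro _ ⟨z, hz, rfl⟩
    exact hρ.monotoneOn hz.1 (hb ha) (hz.2 b hb)
  obtain ⟨z, hz, hmax⟩ := Nat.sSup_mem ⟨_, Set.mem_image_of_mem ρ haD⟩ hbd
  refine ⟨z, fun s hs => ?_, fun c hc => hz.2 c hc⟩
  have hzs : z ⊔ s ∈ D := ⟨hz.1.trans le_sup_left, fun c hc => sup_le (hz.2 c hc) (hc hs)⟩
  by_contra hle
  have hlt : ρ z < ρ (z ⊔ s) := hρ hz.1 hzs.1 (left_lt_sup.2 hle)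
  have := le_csSup hbd (Set.mem_image_of_mem ρ hzs)
  omega

/-- Let `φ` and `T` be commuting automorphisms of a join-semilattice in which the intervals
`[a, T a]` have chains of uniformly bounded length. If the orbit of a point under `φ` escapes
slowly compared to `T`, then `φ x ≤ x` for some `x`. -/
theorem exists_apply_le_self {φ T : α ≃o α} (hcomm : Commute φ T) {N : ℕ}
    (hρ : ∀ a, ∃ ρ : α → ℕ, StrictMonoOn ρ (Set.Ici a) ∧ ρ (T a) < N) {x₀ b : α}
    (hb : ∀ n k : ℕ, n ≤ N * k → (φ ^ n * T⁻¹ ^ k) x₀ ≤ b) : ∃ x, φ x ≤ x := by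
  let S : Set α := {z | ∃ n k : ℕ, n ≤ N * k ∧ (φ ^ n * T⁻¹ ^ k) x₀ = z}
  have hx₀ : x₀ ∈ S := ⟨0, 0, by simp, by simp⟩
  have hbS : b ∈ upperBounds S := by
    rintro _ ⟨n, k, h, rfl⟩
    exact hb n k h
  obtain ⟨ρ₀, hρ₀, -⟩ := hρ x₀
  obtain ⟨y, hy⟩ := exists_isLUB_of_strictMonoOn hx₀ hbS hρ₀
  have hstep : ∀ i ≤ N, (φ ^ i) y ≤ T y := by
    intro i hi
    have hlub : IsLUB ((φ ^ i * T⁻¹ : α ≃o α) '' S) ((φ ^ i * T⁻¹ : α ≃o α) y) :=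
      (OrderIso.isLUB_image' _).2 hy
    -- One more `T⁻¹` pays for up to `N` more factors `φ`; this is what the condition `n ≤ N * k` is
    -- designed for.
    have hsub : (φ ^ i * T⁻¹ : α ≃o α) '' S ⊆ S := by
      rintro _ ⟨_, ⟨n, k, h, rfl⟩, rfl⟩
      refine ⟨i + n, k + 1, by rw [mul_add]; omega, ?_⟩
      have hc : T⁻¹ * φ ^ n = φ ^ n * T⁻¹ := ((hcomm.pow_left n).inv_right).eq.symm
      rw [← RelIso.mul_apply]
      congr 1
      rw [pow_add, pow_succ', mul_assoc, mul_assoc, ← mul_assoc T⁻¹, hc, mul_assoc]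
    have hle := hlub.2 (fun z hz => hy.1 (hsub hz))
    have hc : φ ^ i = T * (φ ^ i * T⁻¹) := by
      rw [← mul_assoc, ← (hcomm.pow_left i).eq, mul_assoc, mul_inv_cancel, mul_one]
    rw [hc]
    exact T.monotone hle
  obtain ⟨ρ, hρ, hN⟩ := hρ y
  let u : ℕ → α := partialSups fun i => (φ ^ i) y
  have hu : Monotone u := (partialSups fun i => (φ ^ i) y).monotone
  have hyu : ∀ i, y ≤ u i := fun i => by
    simpa using le_partialSups_of_le (fun i => (φ ^ i) y) (Nat.zero_le i)
  have huT : u N ≤ T y := partialSups_le _ _ _ hstep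
  have hφu : ∀ i, φ (u i) ≤ u (i + 1) := by
    intro i
    rw [← φ.le_symm_apply]
    refine partialSups_le _ _ _ fun j hj => ?_
    rw [φ.le_symm_apply]
    have := le_partialSups_of_le (fun i => (φ ^ i) y) (Nat.succ_le_succ hj)
    simpa [u, pow_succ'] using this
  by_contra! hno
  have hgrow : ∀ i, i ≤ ρ (u i) := by
    intro i
    induction i with
    | zero => exact Nat.zero_le _
    | succ i ih =>
      have hlt : u i < u (i + 1) := (hu i.le_succ).lt_of_ne fun h =>
        hno (u i) ((hφu i).trans h.ge)
      exact ih.trans_lt (hρ (hyu i) (hyu _) hlt)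
  have h₁ := hgrow N
  have h₂ := hρ.monotoneOn (hyu N) ((hyu N).trans huT) huT
  omega

end Order

/-! ### Atomic length and Garside elements -/

section Monoid

variable {M : Type*} [Monoid M]

/-- In an atomic monoid the maximal length of an atomic factorization is a superadditive function
which vanishes only at `1`. -/
theorem IsAtomicMonoid.exists_length (hM : IsAtomicMonoid M) :
    ∃ ℓ : M → ℕ, (∀ a b, ℓ a + ℓ b ≤ ℓ (a * b)) ∧ ∀ a, a ≠ 1 → 1 ≤ ℓ a := by
  let E : M → Set ℕ := fun a =>
    {n | ∃ l : List M, (∀ x ∈ l, IsMonoidAtom x) ∧ l.prod = a ∧ l.length = n}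
  have hne : ∀ a, (E a).Nonempty := fun a => by
    have ha : a ∈ Submonoid.closure {a : M | IsMonoidAtom a} := by
      rw [hM.closure_atoms]; trivial
    obtain ⟨l, hl, rfl⟩ := Submonoid.exists_list_of_mem_closure ha
    exact ⟨_, l, hl, rfl, rfl⟩
  have hbd : ∀ a, BddAbove (E a) := fun a => by
    refine ⟨(atomNorm a).toNat, ?_⟩
    rintro _ ⟨l, hl, hla, rfl⟩
    have h : (l.length : ℕ∞) ≤ atomNorm a :=
      le_iSup₂_of_le (f := fun (l : List M) (_ : l ∈ {l : List M |
        (∀ x ∈ l, IsMonoidAtom x) ∧ l.prod = a}) => (l.length : ℕ∞)) l ⟨hl, hla⟩ le_rfl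
    simpa using ENat.toNat_le_toNat h (hM.norm_lt_top a).ne
  refine ⟨fun a => sSup (E a), fun a b => ?_, fun a ha => ?_⟩
  · obtain ⟨l, hl, hla, hln⟩ := Nat.sSup_mem (hne a) (hbd a)
    obtain ⟨l', hl', hla', hln'⟩ := Nat.sSup_mem (hne b) (hbd b)
    refine le_csSup (hbd _) ⟨l ++ l', ?_, by simp [hla, hla'], by simp [hln, hln']⟩
    intro x hx
    exact (List.mem_append.1 hx).elim (hl x) (hl' x)
  · obtain ⟨n, l, hl, hla, hln⟩ := hne a
    refine le_trans ?_ (le_csSup (hbd a) ⟨l, hl, hla, rfl⟩)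
    rw [Nat.one_le_iff_ne_zero, Ne, List.length_eq_zero_iff]
    rintro rfl
    exact ha (by simpa using hla.symm)

variable {Δ : M}

/-- For a simple `a`, the complement `c` in `a c = Δ` is a right divisor of `Δ`, hence a left one:
`c d = Δ`, so `a Δ = a c d = Δ d`. -/
theorem IsGarsideElement.exists_mul_eq (hΔ : IsGarsideElement Δ) (a : M) :
    ∃ d, a * Δ = Δ * d := by
  have ha : a ∈ Submonoid.closure {a : M | LeL a Δ} := by rw [hΔ.closure_simple]; trivial
  induction ha using Submonoid.closure_induction with
  | mem a ha =>
    obtain ⟨c, hc⟩ := ha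
    obtain ⟨d, hd⟩ := (hΔ.leL_iff_leR c).2 ⟨a, hc⟩
    exact ⟨d, by rw [← hc, mul_assoc, hc, hd]⟩
  | one => exact ⟨1, by simp⟩
  | mul a b _ _ iha ihb =>
    obtain ⟨c, hc⟩ := iha
    obtain ⟨d, hd⟩ := ihb
    exact ⟨c * d, by rw [mul_assoc, hd, ← mul_assoc, hc, mul_assoc]⟩

theorem IsGarsideElement.exists_eq_mul (hΔ : IsGarsideElement Δ) (a : M) :
    ∃ d, Δ * a = d * Δ := by
  have ha : a ∈ Submonoid.closure {a : M | LeL a Δ} := by rw [hΔ.closure_simple]; trivial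
  induction ha using Submonoid.closure_induction with
  | mem a ha =>
    obtain ⟨c, hc⟩ := (hΔ.leL_iff_leR a).1 ha
    obtain ⟨d, hd⟩ := (hΔ.leL_iff_leR c).1 ⟨a, hc⟩
    exact ⟨d, by rw [← hc, ← mul_assoc, hd, hc]⟩
  | one => exact ⟨1, by simp⟩
  | mul a b _ _ iha ihb =>
    obtain ⟨c, hc⟩ := iha
    obtain ⟨d, hd⟩ := ihb
    exact ⟨c * d, by rw [← mul_assoc, hc, mul_assoc, hd, mul_assoc]⟩

theorem IsGarsideElement.exists_mul_eq_pow (hΔ : IsGarsideElement Δ) (a : M) :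
    ∃ (k : ℕ) (c : M), a * c = Δ ^ k := by
  have ha : a ∈ Submonoid.closure {a : M | LeL a Δ} := by rw [hΔ.closure_simple]; trivial
  induction ha using Submonoid.closure_induction with
  | mem a ha =>
    obtain ⟨c, hc⟩ := ha
    exact ⟨1, c, by simpa using hc⟩
  | one => exact ⟨0, 1, by simp⟩
  | mul a b _ _ iha ihb =>
    obtain ⟨k, c, hc⟩ := iha
    obtain ⟨m, d, hd⟩ := ihb
    have hpow : ∀ m : ℕ, ∀ c : M, ∃ e, c * Δ ^ m = Δ ^ m * e := by
      intro m
      induction m with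
      | zero => exact fun c => ⟨c, by simp⟩
      | succ m ih =>
        intro c
        obtain ⟨e, he⟩ := ih c
        obtain ⟨f, hf⟩ := hΔ.exists_mul_eq e
        exact ⟨f, by rw [pow_succ, ← mul_assoc, he, mul_assoc, hf, mul_assoc]⟩
    obtain ⟨e, he⟩ := hpow m c
    refine ⟨k + m, d * e, ?_⟩
    rw [mul_assoc, ← mul_assoc b, hd, ← he, ← mul_assoc, hc, pow_add]

theorem IsGarsideElement.ne_one [Nontrivial M] (hM : IsLatticeOrder (LeL : M → M → Prop))
    (hΔ : IsGarsideElement Δ) : Δ ≠ 1 := by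
  rintro rfl
  obtain ⟨a, ha⟩ := exists_ne (1 : M)
  obtain ⟨k, c, hc⟩ := hΔ.exists_mul_eq_pow a
  exact ha (hM.antisymm a 1 ⟨c, by simpa using hc⟩ ⟨a, by simp⟩)

end Monoid

/-! ### The order on the group of fractions -/

section Group

variable {M G : Type*} [Monoid M] [Group G] {ι : M →* G} {Δ : M}

theorem GroupLeL.refl (g : G) : GroupLeL ι g g := ⟨1, by simp⟩

theorem GroupLeL.trans {g h k : G} (hgh : GroupLeL ι g h) (hhk : GroupLeL ι h k) :
    GroupLeL ι g k := by
  obtain ⟨c, rfl⟩ := hgh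
  obtain ⟨d, rfl⟩ := hhk
  exact ⟨c * d, by rw [map_mul, mul_assoc]⟩

theorem groupLeL_mul_left_iff {x g h : G} :
    GroupLeL ι (x * g) (x * h) ↔ GroupLeL ι g h := by
  simp [GroupLeL, mul_assoc]

theorem GroupLeL.antisymm (hM : IsLatticeOrder (LeL : M → M → Prop))
    (hι : Function.Injective ι) {g h : G} (hgh : GroupLeL ι g h) (hhg : GroupLeL ι h g) :
    g = h := by
  obtain ⟨c, rfl⟩ := hgh
  obtain ⟨d, hd⟩ := hhg
  have hcd : c * d = 1 := hι (by
    rw [mul_assoc, mul_eq_left] at hd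
    simpa using hd)
  rw [hM.antisymm c 1 ⟨d, hcd⟩ ⟨c, by simp⟩]
  simp

theorem IsGarsideElement.exists_map_mul_zpow (hΔ : IsGarsideElement Δ) (ι : M →* G) (k : ℤ) :
    ∀ p : M, ∃ q, ι p * ι Δ ^ k = ι Δ ^ k * ι q := by
  induction k using Int.induction_on with
  | zero => exact fun p => ⟨p, by simp⟩
  | succ k ih =>
    intro p
    obtain ⟨q, hq⟩ := ih p
    obtain ⟨d, hd⟩ := hΔ.exists_mul_eq q
    refine ⟨d, ?_⟩
    rw [zpow_add_one, ← mul_assoc, hq, mul_assoc, ← map_mul, hd, map_mul, mul_assoc]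
  | pred k ih =>
    intro p
    obtain ⟨q, hq⟩ := ih p
    obtain ⟨d, hd⟩ := hΔ.exists_eq_mul q
    refine ⟨d, ?_⟩
    have hd' : ι q * (ι Δ)⁻¹ = (ι Δ)⁻¹ * ι d := by
      rw [mul_inv_eq_iff_eq_mul, mul_assoc, ← map_mul, ← hd, map_mul, inv_mul_cancel_left]
    rw [zpow_sub_one, ← mul_assoc, hq, mul_assoc, hd', mul_assoc]

theorem IsGarsideElement.groupLeL_mul_zpow (hΔ : IsGarsideElement Δ) {g h : G} (k : ℤ)
    (hgh : GroupLeL ι g h) : GroupLeL ι (g * ι Δ ^ k) (h * ι Δ ^ k) := by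
  obtain ⟨c, rfl⟩ := hgh
  obtain ⟨q, hq⟩ := hΔ.exists_map_mul_zpow ι k c
  exact ⟨q, by rw [mul_assoc, ← hq, mul_assoc]⟩

theorem IsGarsideElement.groupLeL_mul_zpow_iff (hΔ : IsGarsideElement Δ) {g h : G} (k : ℤ) :
    GroupLeL ι (g * ι Δ ^ k) (h * ι Δ ^ k) ↔ GroupLeL ι g h := by
  refine ⟨fun hgh => ?_, hΔ.groupLeL_mul_zpow k⟩
  simpa [mul_assoc] using hΔ.groupLeL_mul_zpow (-k) hgh

theorem IsGarsideElement.groupLeL_zpow_add (hΔ : IsGarsideElement Δ) {g h : G} {r s : ℤ}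
    (hg : GroupLeL ι (ι Δ ^ r) g) (hh : GroupLeL ι (ι Δ ^ s) h) :
    GroupLeL ι (ι Δ ^ (r + s)) (g * h) := by
  rw [zpow_add]
  exact (hΔ.groupLeL_mul_zpow s hg).trans (groupLeL_mul_left_iff.2 hh)

theorem IsGarsideElement.groupLeL_pow_zpow (hΔ : IsGarsideElement Δ) {g : G} {m : ℤ}
    (hg : GroupLeL ι g (ι Δ ^ m)) (n : ℕ) : GroupLeL ι (g ^ n) (ι Δ ^ (m * n)) := by
  induction n with
  | zero => simpa using GroupLeL.refl (1 : G)
  | succ n ih =>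
    rw [pow_succ, Nat.cast_succ, mul_add, mul_one, add_comm, zpow_add]
    exact (groupLeL_mul_left_iff.2 hg).trans (hΔ.groupLeL_mul_zpow m ih) |>.trans
      (by rw [← zpow_add, ← zpow_add, add_comm]; exact GroupLeL.refl _)

theorem groupLeL_zpow_zpow {r s : ℤ} (hrs : r ≤ s) : GroupLeL ι (ι Δ ^ r) (ι Δ ^ s) := by
  obtain ⟨n, rfl⟩ := Int.le.dest hrs
  exact ⟨Δ ^ n, by rw [map_pow, zpow_add, zpow_natCast]⟩

theorem le_of_groupLeL_zpow_zpow (hM : IsLatticeOrder (LeL : M → M → Prop))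
    (hι : Function.Injective ι) (hΔ : Δ ≠ 1) {r s : ℤ}
    (h : GroupLeL ι (ι Δ ^ r) (ι Δ ^ s)) : r ≤ s := by
  by_contra! hsr
  have hs : GroupLeL ι (ι Δ ^ (s + 1)) (ι Δ ^ s) := (groupLeL_zpow_zpow (by omega)).trans h
  have heq := hs.antisymm hM hι (groupLeL_zpow_zpow (by omega))
  rw [zpow_add_one, mul_eq_left] at heq
  exact hΔ (hι (by simpa using heq))

theorem IsGarsideElement.exists_zpow_groupLeL (hΔ : IsGarsideElement Δ)
    (hι : IsGroupOfFractions ι) (g : G) :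
    (∃ r : ℤ, GroupLeL ι (ι Δ ^ r) g) ∧ ∃ r : ℤ, GroupLeL ι g (ι Δ ^ r) := by
  obtain ⟨a, b, rfl⟩ := hι.exists_fraction g
  obtain ⟨k, c, hc⟩ := hΔ.exists_mul_eq_pow b
  obtain ⟨m, d, hd⟩ := hΔ.exists_mul_eq_pow a
  constructor
  · refine ⟨-k, ?_⟩
    obtain ⟨q, hq⟩ := hΔ.exists_map_mul_zpow ι (-k : ℤ) (a * c)
    refine ⟨q, ?_⟩
    rw [← hq, eq_mul_inv_iff_mul_eq, zpow_neg, zpow_natCast, ← map_pow, ← hc]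
    have hcb : ι c * (ι (b * c))⁻¹ * ι b = 1 := by simp
    rw [map_mul ι a c, mul_assoc, mul_assoc, ← mul_assoc (ι c), hcb, mul_one]
  · exact ⟨m, b * d, by simp [← map_pow, ← hd]⟩

/-- Left translation by a power of `Δ` below both elements reduces this to joins in `M`. -/
theorem IsGarsideMonoid.exists_join (hM : IsGarsideMonoid M) (hΔ : IsGarsideElement Δ)
    (hι : IsGroupOfFractions ι) (x y : G) :
    ∃ j, GroupLeL ι x j ∧ GroupLeL ι y j ∧ ∀ z, GroupLeL ι x z → GroupLeL ι y z →
      GroupLeL ι j z := by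
  obtain ⟨⟨r, hr⟩, -⟩ := hΔ.exists_zpow_groupLeL hι x
  obtain ⟨⟨s, hs⟩, -⟩ := hΔ.exists_zpow_groupLeL hι y
  obtain ⟨p, rfl⟩ := (groupLeL_zpow_zpow (min_le_left r s)).trans hr
  obtain ⟨q, rfl⟩ := (groupLeL_zpow_zpow (min_le_right r s)).trans hs
  obtain ⟨j, ⟨c, hc⟩, ⟨d, hd⟩, hj⟩ := hM.latticeL.exists_join p q
  refine ⟨ι Δ ^ (min r s) * ι j, groupLeL_mul_left_iff.2 ⟨c, by rw [← map_mul, hc]⟩,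
    groupLeL_mul_left_iff.2 ⟨d, by rw [← map_mul, hd]⟩, ?_⟩
  rintro _ ⟨c, rfl⟩ ⟨d, hd⟩
  simp only [mul_assoc, mul_right_inj, ← map_mul] at hd
  obtain ⟨e, he⟩ := hj (p * c) ⟨c, rfl⟩ ⟨d, hι.injective hd⟩
  exact ⟨e, by simp only [mul_assoc, ← map_mul, he]⟩

/-- The join-semilattice structure given by `≤_L` on a Garside group. -/
noncomputable abbrev IsGarsideMonoid.semilatticeSup (hM : IsGarsideMonoid M)
    (hΔ : IsGarsideElement Δ) (hι : IsGroupOfFractions ι) : SemilatticeSup G where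
  le := GroupLeL ι
  le_refl := GroupLeL.refl
  le_trans _ _ _ := GroupLeL.trans
  le_antisymm _ _ := GroupLeL.antisymm hM.latticeL hι.injective
  sup x y := (hM.exists_join hΔ hι x y).choose
  le_sup_left x y := (hM.exists_join hΔ hι x y).choose_spec.1
  le_sup_right x y := (hM.exists_join hΔ hι x y).choose_spec.2.1
  sup_le x y z := (hM.exists_join hΔ hι x y).choose_spec.2.2 z

/-- If `Δ ^ (s n - k) ≤_L g ^ n b` for all `n ≤ N k`, where `N` exceeds the length of `Δ`, then
`g` has a conjugate `h` with `Δ ^ s ≤_L h`. -/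
theorem IsGarsideMonoid.exists_conj_groupLeL (hM : IsGarsideMonoid M)
    (hΔ : IsGarsideElement Δ) (hι : IsGroupOfFractions ι) :
    ∃ N : ℕ, 0 < N ∧ ∀ (g b : G) (s : ℤ),
      (∀ n k : ℕ, n ≤ N * k → GroupLeL ι (ι Δ ^ (s * n - k)) (g ^ n * b)) →
      ∃ x : G, GroupLeL ι (ι Δ ^ s) (x⁻¹ * g * x) := by
  obtain ⟨ℓ, hℓ, hℓ₁⟩ := hM.atomic.exists_length
  refine ⟨ℓ Δ + 1, Nat.succ_pos _, fun g b s hb => ?_⟩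
  let _ := hM.semilatticeSup hΔ hι
  let F : G → ℤ → (G ≃o G) := fun g s =>
    { toEquiv := (Equiv.mulLeft g⁻¹).trans (Equiv.mulRight (ι Δ ^ s))
      map_rel_iff' := by
        intro x y
        change GroupLeL ι (g⁻¹ * x * ι Δ ^ s) (g⁻¹ * y * ι Δ ^ s) ↔ GroupLeL ι x y
        rw [hΔ.groupLeL_mul_zpow_iff, groupLeL_mul_left_iff] }
  have hF : ∀ g s x, F g s x = g⁻¹ * x * ι Δ ^ s := fun _ _ _ => rfl
  have hφ : ∀ (n : ℕ) (x : G), (F g s ^ n) x = (g ^ n)⁻¹ * x * ι Δ ^ (s * n) := by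
    intro n
    induction n with
    | zero => simp
    | succ n ih =>
      intro x
      rw [pow_succ', RelIso.mul_apply, ih, hF, Nat.cast_succ, mul_add, mul_one, zpow_add]
      simp only [pow_succ, mul_inv_rev, mul_assoc]
  have hTinv : ∀ x, (F 1 1)⁻¹ x = x * (ι Δ)⁻¹ := fun x => by
    apply (F 1 1).injective
    rw [RelIso.apply_inv_self, hF]
    simp
  have hT : ∀ (k : ℕ) (x : G), ((F 1 1)⁻¹ ^ k) x = x * ι Δ ^ (-k : ℤ) := by
    intro k
    induction k with
    | zero => simp
    | succ k ih =>
      intro x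
      rw [pow_succ', RelIso.mul_apply, ih, hTinv, Nat.cast_succ, neg_add, ← sub_eq_add_neg,
        zpow_sub_one, mul_assoc]
  have hcomm : Commute (F g s) (F 1 1) := by
    refine RelIso.ext fun x => ?_
    simp only [RelIso.mul_apply, hF, inv_one, one_mul, mul_assoc, ← zpow_add]
    rw [add_comm]
  have hrank : ∀ a : G, ∃ ρ : G → ℕ, StrictMonoOn ρ (Set.Ici a) ∧ ρ (F 1 1 a) < ℓ Δ + 1 := by
    intro a
    have hinv := Function.leftInverse_invFun hι.injective
    -- The rank is the atomic length of `a⁻¹ x`; values of `invFun` off the cone above `a` are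
    -- irrelevant.
    refine ⟨fun x => ℓ (Function.invFun ι (a⁻¹ * x)), ?_, ?_⟩
    · rintro _ ⟨c, rfl⟩ _ - hlt
      obtain ⟨⟨d, rfl⟩, hne⟩ := (lt_iff_le_and_ne).1 hlt
      have hd : d ≠ 1 := by
        rintro rfl
        simp at hne
      simp only [mul_assoc, inv_mul_cancel_left, ← map_mul, hinv _]
      have h₁ := hℓ c d
      have h₂ := hℓ₁ d hd
      omega
    · simp [hF, hinv _]
  obtain ⟨x, c, hc⟩ := exists_apply_le_self hcomm hrank (x₀ := 1) (b := b) (by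
    intro n k hnk
    rw [RelIso.mul_apply, hT, hφ, one_mul, mul_assoc, ← zpow_add, neg_add_eq_sub]
    have h := hb n k hnk
    rw [← groupLeL_mul_left_iff (x := (g ^ n)⁻¹), inv_mul_cancel_left] at h
    exact h)
  refine ⟨x, c, ?_⟩
  rw [hF] at hc
  rw [mul_assoc x⁻¹, eq_inv_mul_iff_mul_eq]
  rw [mul_assoc, mul_assoc, inv_mul_eq_iff_eq_mul] at hc
  exact hc

end Group

/-! ### Infimum, its conjugacy maximum and its translation number -/

section Inf

variable {M G : Type*} [Monoid M] [Nontrivial M] [Group G] {ι : M →* G} {Δ : M}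

theorem IsGarsideMonoid.isGreatest_inf (hM : IsGarsideMonoid M) (hΔ : IsGarsideElement Δ)
    (hι : IsGroupOfFractions ι) (g : G) : IsGreatest (infSet ι Δ g) (inf ι Δ g) := by
  obtain ⟨hne, s, hs⟩ := hΔ.exists_zpow_groupLeL hι g
  have hbd : BddAbove (infSet ι Δ g) := ⟨s, fun r hr =>
    le_of_groupLeL_zpow_zpow hM.latticeL hι.injective (hΔ.ne_one hM.latticeL) (hr.trans hs)⟩
  exact ⟨Int.csSup_mem hne hbd, fun r hr => le_csSup hbd hr⟩

theorem IsGarsideMonoid.le_inf_iff (hM : IsGarsideMonoid M) (hΔ : IsGarsideElement Δ)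
    (hι : IsGroupOfFractions ι) {g : G} {r : ℤ} :
    r ≤ inf ι Δ g ↔ GroupLeL ι (ι Δ ^ r) g := by
  have h := hM.isGreatest_inf hΔ hι g
  exact ⟨fun hr => (groupLeL_zpow_zpow hr).trans h.1, fun hr => h.2 hr⟩

theorem IsGarsideMonoid.inf_add_inf_le (hM : IsGarsideMonoid M) (hΔ : IsGarsideElement Δ)
    (hι : IsGroupOfFractions ι) (g h : G) :
    inf ι Δ g + inf ι Δ h ≤ inf ι Δ (g * h) :=
  (hM.le_inf_iff hΔ hι).2 <| hΔ.groupLeL_zpow_add (hM.isGreatest_inf hΔ hι g).1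
    (hM.isGreatest_inf hΔ hι h).1

theorem IsGarsideMonoid.mul_inf_le_inf_pow (hM : IsGarsideMonoid M) (hΔ : IsGarsideElement Δ)
    (hι : IsGroupOfFractions ι) (g : G) (n : ℕ) : n * inf ι Δ g ≤ inf ι Δ (g ^ n) := by
  induction n with
  | zero => simpa using (hM.le_inf_iff hΔ hι (r := 0)).2 (by simpa using GroupLeL.refl (1 : G))
  | succ n ih =>
    have h := hM.inf_add_inf_le hΔ hι (g ^ n) g
    rw [pow_succ]
    push_cast
    linarith

theorem IsGarsideMonoid.tendsto_inf_pow_div (hM : IsGarsideMonoid M) (hΔ : IsGarsideElement Δ)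
    (hι : IsGroupOfFractions ι) (g : G) :
    Tendsto (fun n : ℕ => (inf ι Δ (g ^ n) : ℝ) / (n : ℝ)) atTop (𝓝 (tInf ι Δ g)) := by
  obtain ⟨-, m, hm⟩ := hΔ.exists_zpow_groupLeL hι g
  have hsub : Subadditive fun n : ℕ => -(inf ι Δ (g ^ n) : ℝ) := by
    intro n k
    have h : (inf ι Δ (g ^ n) + inf ι Δ (g ^ k) : ℝ) ≤ inf ι Δ (g ^ (n + k)) := by
      rw [pow_add]
      exact_mod_cast hM.inf_add_inf_le hΔ hι (g ^ n) (g ^ k)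
    linarith
  have hbd : BddBelow (Set.range fun n : ℕ => -(inf ι Δ (g ^ n) : ℝ) / n) := by
    -- The `0` covers `n = 0`, where the quotient is `0` by convention.
    refine ⟨min 0 (-m), ?_⟩
    rintro _ ⟨n, rfl⟩
    rcases Nat.eq_zero_or_pos n with rfl | hn
    · simp
    refine (min_le_right _ _).trans ?_
    have hle : inf ι Δ (g ^ n) ≤ m * n :=
      le_of_groupLeL_zpow_zpow hM.latticeL hι.injective (hΔ.ne_one hM.latticeL)
        ((hM.isGreatest_inf hΔ hι _).1.trans (hΔ.groupLeL_pow_zpow hm n))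
    have hle' : (inf ι Δ (g ^ n) : ℝ) ≤ m * n := by exact_mod_cast hle
    have hn' : (0 : ℝ) < n := by exact_mod_cast hn
    rw [le_div_iff₀ hn']
    linarith
  have h := (hsub.tendsto_lim hbd).neg
  exact tendsto_nhds_limUnder ⟨_, h.congr fun n => by rw [neg_div, neg_neg]⟩

theorem IsGarsideMonoid.inf_le_tInf_of_mem_conjClass (hM : IsGarsideMonoid M)
    (hΔ : IsGarsideElement Δ) (hι : IsGroupOfFractions ι) {g h : G} (hh : h ∈ conjClass g) :
    (inf ι Δ h : ℝ) ≤ tInf ι Δ g := by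
  obtain ⟨x, rfl⟩ := hh
  set r := inf ι Δ (x⁻¹ * g * x) with hr
  set C : ℝ := inf ι Δ x + inf ι Δ x⁻¹ with hC
  have hlim : Tendsto (fun n : ℕ => (r : ℝ) + C / n) atTop (𝓝 r) := by
    simpa using tendsto_const_nhds.add (tendsto_const_div_atTop_nhds_zero_nat C)
  refine le_of_tendsto_of_tendsto hlim (hM.tendsto_inf_pow_div hΔ hι g) ?_
  filter_upwards [eventually_gt_atTop 0] with n hn
  have hconj : x * (x⁻¹ * g * x) ^ n * x⁻¹ = g ^ n := by
    rw [← conj_pow]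
    congr 1
    group
  have h₁ := hM.mul_inf_le_inf_pow hΔ hι (x⁻¹ * g * x) n
  have h₂ := hM.inf_add_inf_le hΔ hι x ((x⁻¹ * g * x) ^ n)
  have h₃ := hM.inf_add_inf_le hΔ hι (x * (x⁻¹ * g * x) ^ n) x⁻¹
  rw [hconj] at h₃
  have h₄ : (n * r + (inf ι Δ x + inf ι Δ x⁻¹) : ℝ) ≤ inf ι Δ (g ^ n) := by
    have : n * r + (inf ι Δ x + inf ι Δ x⁻¹) ≤ inf ι Δ (g ^ n) := by linarith
    exact_mod_cast this
  have hn' : (0 : ℝ) < n := by exact_mod_cast hn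
  rw [le_div_iff₀ hn', add_mul, div_mul_cancel₀ _ hn'.ne']
  linarith

theorem IsGarsideMonoid.isGreatest_infS (hM : IsGarsideMonoid M) (hΔ : IsGarsideElement Δ)
    (hι : IsGroupOfFractions ι) (g : G) :
    IsGreatest (inf ι Δ '' conjClass g) (infS ι Δ g) := by
  have hne : (inf ι Δ '' conjClass g).Nonempty := ⟨_, g, ⟨1, by simp⟩, rfl⟩
  have hbd : BddAbove (inf ι Δ '' conjClass g) := by
    refine ⟨⌊tInf ι Δ g⌋, ?_⟩
    rintro _ ⟨h, hh, rfl⟩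
    exact Int.le_floor.2 (hM.inf_le_tInf_of_mem_conjClass hΔ hι hh)
  exact ⟨Int.csSup_mem hne hbd, fun r hr => le_csSup hbd hr⟩

/-- If `s ≤ t_inf(g)` for an integer `s`, then `s ≤ inf(h)` for some conjugate `h` of `g`. -/
theorem IsGarsideMonoid.exists_le_inf_of_le_tInf (hM : IsGarsideMonoid M)
    (hΔ : IsGarsideElement Δ) (hι : IsGroupOfFractions ι) {g : G} {s : ℤ}
    (hs : (s : ℝ) ≤ tInf ι Δ g) : ∃ h ∈ conjClass g, s ≤ inf ι Δ h := by
  obtain ⟨N, hN, hconj⟩ := hM.exists_conj_groupLeL hΔ hι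
  have hN' : (0 : ℝ) < N := by exact_mod_cast hN
  have hlt : (s : ℝ) - 1 / N < tInf ι Δ g := by
    have : (0 : ℝ) < 1 / N := by positivity
    linarith
  obtain ⟨n₀, hn₀⟩ := eventually_atTop.1
    ((hM.tendsto_inf_pow_div hΔ hι g).eventually_const_lt hlt)
  -- `C` absorbs the finitely many `n` for which the asymptotic estimate may fail.
  obtain ⟨C, hC⟩ := ((Set.finite_Iic n₀).image
    fun n : ℕ => s * n - inf ι Δ (g ^ n)).bddAbove
  obtain ⟨x, hx⟩ := hconj g (ι Δ ^ max C 0) s (by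
    intro n k hnk
    have hle : s * n - k - max C 0 ≤ inf ι Δ (g ^ n) := by
      rcases le_total n n₀ with hn | hn
      · have h₁ := hC ⟨n, hn, rfl⟩
        have h₂ := le_max_left C 0
        dsimp only at h₁
        omega
      · suffices h : (s * n - k : ℝ) ≤ inf ι Δ (g ^ n) by
          have h' : s * n - k ≤ inf ι Δ (g ^ n) := by exact_mod_cast h
          have h₂ := le_max_right C 0
          omega
        rcases Nat.eq_zero_or_pos n with rfl | hn'
        · have := hM.mul_inf_le_inf_pow hΔ hι g 0
          have h0 : (0 : ℝ) ≤ inf ι Δ (g ^ 0) := by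
            exact_mod_cast (by simpa using this)
          have hk : (0 : ℝ) ≤ k := k.cast_nonneg
          push_cast
          linarith
        · have hn'' : (0 : ℝ) < n := by exact_mod_cast hn'
          have h := (hn₀ n hn).le
          rw [le_div_iff₀ hn'', sub_mul, one_div_mul_eq_div] at h
          -- The loss `n / N` in the estimate is at most `k`, the number of factors `T⁻¹`.
          have hk : (n : ℝ) / N ≤ k := by
            rw [div_le_iff₀ hN', mul_comm]
            exact_mod_cast hnk
          linarith
    have h := hΔ.groupLeL_mul_zpow (max C 0) ((hM.le_inf_iff hΔ hι).1 hle)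
    rwa [← zpow_add, sub_add_cancel] at h)
  exact ⟨_, ⟨x, rfl⟩, (hM.le_inf_iff hΔ hι).2 hx⟩

end Inf

end Garside

/-- For every element `g` of a Garside group, `inf_s(g) ≤ t_inf(g) < inf_s(g) + 1`, hence
`inf_s(g) = ⌊t_inf(g)⌋`. The first three conjuncts say that the maxima and the limit that define
`inf`, `inf_s(g)` and `t_inf(g)` exist. The trivial monoid, for which `Δ = 1` and `inf` is
undefined, is excluded. -/
theorem theorem3p2 {M G : Type*} [Monoid M] [Nontrivial M] [Group G]
    (hM : Garside.IsGarsideMonoid M)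
    (Δ : M) (hΔ : Garside.IsGarsideElement Δ)
    (ι : M →* G) (hι : Garside.IsGroupOfFractions ι) (g : G) :
    (∀ h : G, IsGreatest (Garside.infSet ι Δ h) (Garside.inf ι Δ h)) ∧
    IsGreatest (Garside.inf ι Δ '' Garside.conjClass g) (Garside.infS ι Δ g) ∧
    Tendsto (fun n : ℕ => (Garside.inf ι Δ (g ^ n) : ℝ) / (n : ℝ)) atTop
      (𝓝 (Garside.tInf ι Δ g)) ∧
    (Garside.infS ι Δ g : ℝ) ≤ Garside.tInf ι Δ g ∧
    Garside.tInf ι Δ g < (Garside.infS ι Δ g : ℝ) + 1 ∧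
    Garside.infS ι Δ g = ⌊Garside.tInf ι Δ g⌋ := by
  have hS := hM.isGreatest_infS hΔ hι g
  have hle : (Garside.infS ι Δ g : ℝ) ≤ Garside.tInf ι Δ g := by
    obtain ⟨h, hh, heq⟩ := hS.1
    rw [← heq]
    exact hM.inf_le_tInf_of_mem_conjClass hΔ hι hh
  have hlt : Garside.tInf ι Δ g < (Garside.infS ι Δ g : ℝ) + 1 := by
    by_contra! hge
    obtain ⟨h, hh, hs⟩ := hM.exists_le_inf_of_le_tInf hΔ hι
      (s := Garside.infS ι Δ g + 1) (by exact_mod_cast hge)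
    have := hS.2 (Set.mem_image_of_mem _ hh)
    omega
  exact ⟨hM.isGreatest_inf hΔ hι, hS, hM.tendsto_inf_pow_div hΔ hι g, hle, hlt,
    (Int.floor_eq_iff.2 ⟨hle, hlt⟩).symm⟩
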